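/- Let $\mathbb{D}\subset\mathbb{C}$ be the open unit disc and let $\partial=\tfrac12(\partial_x-i\partial_y)$, $\bar\partial=\tfrac12(\partial_x+i\partial_y)$ be the Wirtinger derivatives. For $\gamma_1,\gamma_2\in\mathbb{C}$, a function $u\in C^2(\mathbb{D})$ (complex-valued) is called $(\gamma_1,\gamma_2)$-harmonic on $\mathbb{D}$ if $$(1-|z|^2)\,\partial\bar\partial u+\gamma_1 z\,\partial u+\gamma_2\bar z\,\bar\partial u-\gamma_1\gamma_2 u=0\quad\text{in }\mathbb{D}.$$ For an integer $n\ge 0$, a function $u\in C^{2n}(\mathbb{D})$ is called polyharmonic of order $n$ on $\mathbb{D}$ if $\partial^n\bar\partial^n u=0$ in $\mathbb{D}$. Let $\gamma_1,\gamma_2\ge 0$ be integers and let $u\in C^\infty(\mathbb{D})$ be $(\gamma_1,\gamma_2)$-harmonic on $\mathbb{D}$. Then there are functions $P_1,P_2,P_3\in C^\infty(\mathbb{D})$ with $$u(z)=P_1(z)+P_2(z)+P_3(z),\qquad z\in\mathbb{D},$$ such that $P_1$ is polyharmonic of order $\gamma_1+1$, $P_2$ is polyharmonic of order $\gamma_2+1$,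 and $P_3$ is polyharmonic of order $\min(\gamma_1+1,\gamma_2+1)$. Moreover, $u$ is polyharmonic of order $\max(\gamma_1+1,\gamma_2+1)$ on $\mathbb{D}$. In particular, for every integer $n\ge 1$, every $(n-1,n-1)$-harmonic function $u\in C^\infty(\mathbb{D})$ is polyharmonic of order $n$ on $\mathbb{D}$. -/

import Mathlib

open scoped ContDiff

namespace GenHarmonic

/-- The open unit disc in `ℂ`. -/
def disc : Set ℂ := Metric.ball 0 1

/-- The Wirtinger derivative `∂ = (∂ₓ - i ∂ᵧ) / 2`. -/
noncomputable def dz (f : ℂ → ℂ) (z : ℂ) : ℂ :=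
  (fderiv ℝ f z 1 - Complex.I * fderiv ℝ f z Complex.I) / 2

/-- The Wirtinger derivative `∂̄ = (∂ₓ + i ∂ᵧ) / 2`. -/
noncomputable def dzbar (f : ℂ → ℂ) (z : ℂ) : ℂ :=
  (fderiv ℝ f z 1 + Complex.I * fderiv ℝ f z Complex.I) / 2

/-- The operator `L = (1 - |z|²) ∂∂̄ + γ₁ z ∂ + γ₂ z̄ ∂̄ - γ₁ γ₂`. -/
noncomputable def L (γ₁ γ₂ : ℂ) (u : ℂ → ℂ) (z : ℂ) : ℂ :=
  (1 - (‖z‖ : ℂ) ^ 2) * dz (dzbar u) z + γ₁ * z * dz u z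
    + γ₂ * (starRingEnd ℂ) z * dzbar u z - γ₁ * γ₂ * u z

/-- `u` restricts to an element of `C^∞(𝔻)`. Only the values of `u` on the disc matter. -/
def SmoothOnDisc (u : ℂ → ℂ) : Prop := ContDiffOn ℝ ∞ u disc

/-- `u` is a `(γ₁, γ₂)`-harmonic function on the disc: a `C²` solution of `L u = 0`. -/
def IsHarmonicWith (γ₁ γ₂ : ℂ) (u : ℂ → ℂ) : Prop :=
  ContDiffOn ℝ 2 u disc ∧ ∀ z ∈ disc, L γ₁ γ₂ u z = 0

/-- `u` is polyharmonic of order `n` on the disc: `u ∈ C^{2n}` and `∂ⁿ ∂̄ⁿ u = 0`. -/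
def IsPolyharmonic (n : ℕ) (u : ℂ → ℂ) : Prop :=
  ContDiffOn ℝ (2 * n : ℕ) u disc ∧ ∀ z ∈ disc, dz^[n] (dzbar^[n] u) z = 0

end GenHarmonic

/-!
The operator `L a b` satisfies `∂ L a b = L a (b - 1) ∂` and `∂̄ L a b = L (a - 1) b ∂̄`. Applying
`∂ⁿ ∂̄ᵐ` to `L m n u = 0` therefore lowers both parameters to zero, so that `w = ∂ⁿ ∂̄ᵐ u` solves
`L 0 0 w = (1 - |z|²) ∂∂̄ w = 0`. The factor `1 - |z|²` vanishes only on a nowhere dense set, hence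
`∂ⁿ⁺¹ ∂̄ᵐ⁺¹ u = ∂∂̄ w = 0`.
-/

namespace GenHarmonic

open Complex ComplexConjugate

variable {f g u : ℂ → ℂ} {U : Set ℂ} {c d z : ℂ}

/-- The first-order operator `(∂ₓ + c ∂ᵧ) / 2`. Both Wirtinger derivatives belong to this family:
`∂` is the case `c = -i` and `∂̄` is the case `c = i`. -/
noncomputable def wirtinger (c : ℂ) (f : ℂ → ℂ) (z : ℂ) : ℂ :=
  (fderiv ℝ f z 1 + c * fderiv ℝ f z I) / 2

lemma dz_eq_wirtinger : dz = wirtinger (-I) := by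
  funext f z
  simp only [dz, wirtinger, neg_mul, sub_eq_add_neg]

lemma dzbar_eq_wirtinger : dzbar = wirtinger I := rfl

lemma wirtinger_const (a : ℂ) : wirtinger c (fun _ => a) z = 0 := by
  simp [wirtinger]

lemma wirtinger_id : wirtinger c (fun w => w) z = (1 + c * I) / 2 := by
  simp [wirtinger]

lemma wirtinger_conj : wirtinger c (fun w => conj w) z = (1 - c * I) / 2 := by
  have hconj : fderiv ℝ (fun w : ℂ => conj w) z = (conjCLE : ℂ →L[ℝ] ℂ) := conjCLE.fderiv
  simp [wirtinger, hconj, sub_eq_add_neg]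

lemma wirtinger_add (hf : DifferentiableAt ℝ f z) (hg : DifferentiableAt ℝ g z) :
    wirtinger c (fun w => f w + g w) z = wirtinger c f z + wirtinger c g z := by
  simp only [wirtinger, fderiv_fun_add hf hg, add_apply]
  ring

lemma wirtinger_sub (hf : DifferentiableAt ℝ f z) (hg : DifferentiableAt ℝ g z) :
    wirtinger c (fun w => f w - g w) z = wirtinger c f z - wirtinger c g z := by
  simp only [wirtinger, fderiv_fun_sub hf hg, sub_apply]
  ring

lemma wirtinger_mul (hf : DifferentiableAt ℝ f z) (hg : DifferentiableAt ℝ g z) :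
    wirtinger c (fun w => f w * g w) z = f z * wirtinger c g z + wirtinger c f z * g z := by
  simp only [wirtinger, fderiv_fun_mul hf hg, add_apply, smul_apply, smul_eq_mul]
  ring

lemma wirtinger_eqOn (hU : IsOpen U) (h : Set.EqOn f g U) :
    Set.EqOn (wirtinger c f) (wirtinger c g) U := fun z hz => by
  have hfderiv : fderiv ℝ f z = fderiv ℝ g z :=
    (h.eventuallyEq_of_mem (hU.mem_nhds hz)).fderiv_eq
  simp only [wirtinger, hfderiv]

lemma iterate_wirtinger_eqOn (hU : IsOpen U) (k : ℕ) (h : Set.EqOn f g U) :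
    Set.EqOn ((wirtinger c)^[k] f) ((wirtinger c)^[k] g) U := by
  induction k generalizing f g with
  | zero => exact h
  | succ _ ih => exact ih (wirtinger_eqOn hU h)

lemma wirtinger_zero : wirtinger c 0 = 0 := funext fun _ => wirtinger_const 0

lemma iterate_wirtinger_zero (k : ℕ) : (wirtinger c)^[k] 0 = 0 :=
  Function.iterate_fixed wirtinger_zero k

lemma wirtinger_eqOn_zero (hU : IsOpen U) (h : Set.EqOn f 0 U) :
    Set.EqOn (wirtinger c f) 0 U := by
  simpa only [wirtinger_zero] using wirtinger_eqOn (c := c) hU h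

lemma iterate_wirtinger_eqOn_zero (hU : IsOpen U) (k : ℕ) (h : Set.EqOn f 0 U) :
    Set.EqOn ((wirtinger c)^[k] f) 0 U := by
  simpa only [iterate_wirtinger_zero] using iterate_wirtinger_eqOn (c := c) hU k h

lemma contDiffOn_wirtinger {m n : WithTop ℕ∞} (hU : IsOpen U) (hf : ContDiffOn ℝ n f U)
    (hmn : m + 1 ≤ n) : ContDiffOn ℝ m (wirtinger c f) U := by
  have hfderiv (v : ℂ) : ContDiffOn ℝ m (fun z => fderiv ℝ f z v) U :=
    (hf.fderiv_of_isOpen hU hmn).clm_apply contDiffOn_const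
  exact ((hfderiv 1).add (contDiffOn_const.mul (hfderiv I))).div_const 2

lemma contDiffOn_iterate_wirtinger {n : WithTop ℕ∞} (hU : IsOpen U) (k : ℕ)
    (hf : ContDiffOn ℝ (n + k) f U) : ContDiffOn ℝ n ((wirtinger c)^[k] f) U := by
  induction k generalizing f with
  | zero => simpa using hf
  | succ k ih =>
    exact ih (contDiffOn_wirtinger hU hf (by rw [Nat.cast_succ, add_assoc]))

lemma fderiv_wirtinger (hf : ContDiffAt ℝ 2 f z) (v : ℂ) :
    fderiv ℝ (wirtinger c f) z v =
      (fderiv ℝ (fderiv ℝ f) z v 1 + c * fderiv ℝ (fderiv ℝ f) z v I) / 2 := by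
  have hf' : DifferentiableAt ℝ (fderiv ℝ f) z :=
    (hf.fderiv_right (m := 1) one_add_one_eq_two.le).differentiableAt one_ne_zero
  have hpartial (w : ℂ) := hf'.hasFDerivAt.clm_apply (hasFDerivAt_const w z)
  have hwirtinger : HasFDerivAt (wirtinger c f) _ z :=
    ((hpartial 1).add ((hpartial I).const_mul c)).mul_const (2 : ℂ)⁻¹
  rw [hwirtinger.fderiv]
  simp [div_eq_inv_mul, mul_add]

lemma wirtinger_comm (hf : ContDiffAt ℝ 2 f z) :
    wirtinger c (wirtinger d f) z = wirtinger d (wirtinger c f) z := by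
  have hsymm : fderiv ℝ (fderiv ℝ f) z 1 I = fderiv ℝ (fderiv ℝ f) z I 1 :=
    hf.isSymmSndFDerivAt (by simp) 1 I
  rw [wirtinger, wirtinger, fderiv_wirtinger hf, fderiv_wirtinger hf, fderiv_wirtinger hf,
    fderiv_wirtinger hf, hsymm]
  ring

lemma wirtinger_comm_eqOn (hU : IsOpen U) (hf : ContDiffOn ℝ 2 f U) :
    Set.EqOn (wirtinger c (wirtinger d f)) (wirtinger d (wirtinger c f)) U :=
  fun _ hz => wirtinger_comm (hf.contDiffAt (hU.mem_nhds hz))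

lemma wirtinger_iterate_wirtinger_comm (hU : IsOpen U) (k : ℕ)
    (hf : ContDiffOn ℝ (k + 1) f U) :
    Set.EqOn (wirtinger c ((wirtinger d)^[k] f)) ((wirtinger d)^[k] (wirtinger c f)) U := by
  induction k generalizing f with
  | zero => exact Set.eqOn_refl _ _
  | succ k ih =>
    have hf2 : ContDiffOn ℝ 2 f U := hf.of_le (by norm_cast; lia)
    exact (ih (contDiffOn_wirtinger hU hf (by norm_cast))).trans
      (iterate_wirtinger_eqOn hU k (wirtinger_comm_eqOn hU hf2))

lemma iterate_wirtinger_comm (hU : IsOpen U) (j k : ℕ) (hf : ContDiffOn ℝ (j + k) f U) :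
    Set.EqOn ((wirtinger c)^[j] ((wirtinger d)^[k] f))
      ((wirtinger d)^[k] ((wirtinger c)^[j] f)) U := by
  induction j generalizing f with
  | zero => exact Set.eqOn_refl _ _
  | succ j ih =>
    have hf_succ : ContDiffOn ℝ (k + 1) f U := hf.of_le (by norm_cast; lia)
    exact (iterate_wirtinger_eqOn hU j (wirtinger_iterate_wirtinger_comm hU k hf_succ)).trans
      (ih (contDiffOn_wirtinger hU hf (by norm_cast; lia)))

lemma L_eq_wirtinger (a b : ℂ) (u : ℂ → ℂ) : L a b u = fun z =>
    (1 - z * conj z) * wirtinger (-I) (wirtinger I u) z + a * (z * wirtinger (-I) u z)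
      + b * (conj z * wirtinger I u z) - a * b * u z := by
  funext z
  rw [L, mul_conj', dz_eq_wirtinger, dzbar_eq_wirtinger, mul_assoc a, mul_assoc b]

lemma wirtinger_L (hU : IsOpen U) (hu : ContDiffOn ℝ 3 u U) (hz : z ∈ U) (a b : ℂ) :
    wirtinger c (L a b u) z = L a b (wirtinger c u) z
      - ((1 + c * I) / 2 * conj z + (1 - c * I) / 2 * z) * dz (dzbar u) z
      + a * ((1 + c * I) / 2) * dz u z + b * ((1 - c * I) / 2) * dzbar u z := by
  have hu' (e : ℂ) : ContDiffOn ℝ 2 (wirtinger e u) U :=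
    contDiffOn_wirtinger hU hu (by norm_num)
  have hu'' : ContDiffOn ℝ 1 (wirtinger (-I) (wirtinger I u)) U :=
    contDiffOn_wirtinger hU (hu' I) (by norm_num)
  have hUz := hU.mem_nhds hz
  have hdiff : DifferentiableAt ℝ u z := (hu.contDiffAt hUz).differentiableAt (by simp)
  have hdiff' (e : ℂ) : DifferentiableAt ℝ (wirtinger e u) z :=
    ((hu' e).contDiffAt hUz).differentiableAt (by simp)
  have hdiff'' := (hu''.contDiffAt hUz).differentiableAt one_ne_zero
  have hdiff_conj : DifferentiableAt ℝ (fun w : ℂ => conj w) z := conjCLE.differentiableAt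
  have hcomm (e : ℂ) : Set.EqOn (wirtinger c (wirtinger e u)) (wirtinger e (wirtinger c u)) U :=
    wirtinger_comm_eqOn hU (hu.of_le (by norm_num))
  have hcomm' : wirtinger c (wirtinger (-I) (wirtinger I u)) z =
      wirtinger (-I) (wirtinger I (wirtinger c u)) z :=
    (wirtinger_comm_eqOn hU (hu' I) hz).trans (wirtinger_eqOn hU (hcomm I) hz)
  simp (disch := fun_prop) only [L_eq_wirtinger, dz_eq_wirtinger, dzbar_eq_wirtinger,
    wirtinger_sub, wirtinger_add, wirtinger_mul, wirtinger_const, wirtinger_id, wirtinger_conj,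
    hcomm _ hz, hcomm']
  ring

lemma dz_L (hU : IsOpen U) (hu : ContDiffOn ℝ 3 u U) (a b : ℂ) :
    Set.EqOn (dz (L a b u)) (L a (b - 1) (dz u)) U := fun z hz => by
  have hcomm : dzbar (dz u) z = dz (dzbar u) z := by
    simpa only [dz_eq_wirtinger, dzbar_eq_wirtinger] using
      wirtinger_comm_eqOn hU (hu.of_le (by norm_num)) hz
  have h := wirtinger_L (c := -I) hU hu hz a b
  rw [← dz_eq_wirtinger, neg_mul, I_mul_I] at h
  rw [h, L, L, hcomm]
  ring

lemma dzbar_L (hU : IsOpen U) (hu : ContDiffOn ℝ 3 u U) (a b : ℂ) :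
    Set.EqOn (dzbar (L a b u)) (L (a - 1) b (dzbar u)) U := fun z hz => by
  have h := wirtinger_L (c := I) hU hu hz a b
  rw [← dzbar_eq_wirtinger, I_mul_I] at h
  rw [h, L, L]
  ring

lemma L_iterate_dz_eqOn_zero (hU : IsOpen U) (k : ℕ) {a b : ℂ}
    (hu : ContDiffOn ℝ (k + 2) u U) (h : Set.EqOn (L a b u) 0 U) :
    Set.EqOn (L a (b - k) (dz^[k] u)) 0 U := by
  induction k generalizing u b with
  | zero => simpa using h
  | succ k ih =>
    have hu3 : ContDiffOn ℝ 3 u U := hu.of_le (by norm_cast; lia)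
    have hdz : Set.EqOn (L a (b - 1) (dz u)) 0 U := (dz_L hU hu3 a b).symm.trans <| by
      rw [dz_eq_wirtinger]
      exact wirtinger_eqOn_zero hU h
    rw [Nat.cast_succ, add_comm, ← sub_sub]
    refine ih ?_ hdz
    rw [dz_eq_wirtinger]
    exact contDiffOn_wirtinger hU hu (by norm_cast)

lemma L_iterate_dzbar_eqOn_zero (hU : IsOpen U) (k : ℕ) {a b : ℂ}
    (hu : ContDiffOn ℝ (k + 2) u U) (h : Set.EqOn (L a b u) 0 U) :
    Set.EqOn (L (a - k) b (dzbar^[k] u)) 0 U := by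
  induction k generalizing u a with
  | zero => simpa using h
  | succ k ih =>
    have hu3 : ContDiffOn ℝ 3 u U := hu.of_le (by norm_cast; lia)
    have hdzbar : Set.EqOn (L (a - 1) b (dzbar u)) 0 U :=
      (dzbar_L hU hu3 a b).symm.trans (wirtinger_eqOn_zero hU h)
    rw [Nat.cast_succ, add_comm, ← sub_sub]
    exact ih (contDiffOn_wirtinger hU hu (by norm_cast)) hdzbar

lemma dz_dzbar_eqOn_zero_of_L_zero_zero (hU : IsOpen U) (hu : ContDiffOn ℝ 2 u U)
    (h : Set.EqOn (L 0 0 u) 0 U) : Set.EqOn (dz (dzbar u)) 0 U := by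
  have hoff_circle : Set.EqOn (dz (dzbar u)) 0 (U ∩ (Metric.sphere 0 1)ᶜ) := by
    rintro z ⟨hzU, hz⟩
    have hz_norm : (1 : ℂ) - (‖z‖ : ℂ) ^ 2 ≠ 0 := by
      have hz_sq : ‖z‖ ^ 2 ≠ 1 := by
        rw [ne_eq, pow_eq_one_iff_of_nonneg (norm_nonneg z) two_ne_zero]
        simpa using hz
      exact sub_ne_zero.mpr (mod_cast hz_sq.symm)
    have hLz : (1 - (‖z‖ : ℂ) ^ 2) * dz (dzbar u) z = 0 := by simpa [L] using h hzU
    exact (mul_eq_zero.mp hLz).resolve_left hz_norm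
  -- On the unit circle `L 0 0` degenerates, and the equation is recovered by continuity.
  have hdense : Dense (Metric.sphere (0 : ℂ) 1)ᶜ :=
    interior_eq_empty_iff_dense_compl.mp (interior_sphere 0 one_ne_zero)
  have hcont : ContinuousOn (dz (dzbar u)) U := by
    rw [dz_eq_wirtinger]
    exact (contDiffOn_wirtinger (m := 0) hU
      (contDiffOn_wirtinger (m := 1) hU hu (by norm_num)) (by norm_num)).continuousOn
  exact hoff_circle.of_subset_closure hcont continuousOn_const Set.inter_subset_left
    (hdense.open_subset_closure_inter hU)

theorem iterate_dz_iterate_dzbar_eqOn_zero (hU : IsOpen U) (m n : ℕ)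
    (hu : ContDiffOn ℝ (m + n + 2) u U) (h : Set.EqOn (L m n u) 0 U) :
    Set.EqOn (dz^[n + 1] (dzbar^[m + 1] u)) 0 U := by
  have hv : ContDiffOn ℝ (n + 2) (dzbar^[m] u) U :=
    contDiffOn_iterate_wirtinger hU m (hu.of_le (by norm_cast; lia))
  have hw : ContDiffOn ℝ 2 (dz^[n] (dzbar^[m] u)) U := by
    rw [dz_eq_wirtinger]
    exact contDiffOn_iterate_wirtinger hU n (hv.of_le (by norm_cast; lia))
  have hLv : Set.EqOn (L 0 n (dzbar^[m] u)) 0 U := by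
    simpa using L_iterate_dzbar_eqOn_zero hU m (hu.of_le (by norm_cast; lia)) h
  have hLw : Set.EqOn (L 0 0 (dz^[n] (dzbar^[m] u))) 0 U := by
    simpa using L_iterate_dz_eqOn_zero hU n hv hLv
  have hcomm : Set.EqOn (dzbar (dz^[n] (dzbar^[m] u))) (dz^[n] (dzbar (dzbar^[m] u))) U := by
    rw [dz_eq_wirtinger]
    exact wirtinger_iterate_wirtinger_comm hU n (hv.of_le (by norm_cast; lia))
  rw [Function.iterate_succ_apply', Function.iterate_succ_apply']
  refine Set.EqOn.trans ?_ (dz_dzbar_eqOn_zero_of_L_zero_zero hU hw hLw)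
  rw [dz_eq_wirtinger] at hcomm ⊢
  exact (wirtinger_eqOn hU hcomm).symm

lemma iterate_dz_iterate_dzbar_eqOn_zero_of_le (hU : IsOpen U) {j k m n : ℕ} (hjm : j ≤ m)
    (hkn : k ≤ n) (hu : ContDiffOn ℝ (m + n) u U)
    (h : Set.EqOn (dz^[k] (dzbar^[j] u)) 0 U) : Set.EqOn (dz^[n] (dzbar^[m] u)) 0 U := by
  obtain ⟨p, rfl⟩ := Nat.exists_eq_add_of_le' hjm
  obtain ⟨q, rfl⟩ := Nat.exists_eq_add_of_le' hkn
  rw [dz_eq_wirtinger, dzbar_eq_wirtinger] at h ⊢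
  have hv : ContDiffOn ℝ (k + p) ((wirtinger I)^[j] u) U :=
    contDiffOn_iterate_wirtinger hU j (hu.of_le (by norm_cast; lia))
  rw [Function.iterate_add_apply, Function.iterate_add_apply]
  exact iterate_wirtinger_eqOn_zero hU q
    ((iterate_wirtinger_comm hU k p hv).trans (iterate_wirtinger_eqOn_zero hU p h))

/-- Polyharmonicity of order `n` on a set `U`, meant for open `U`; `IsPolyharmonic n` is the case
of the unit disc. -/
def IsPolyharmonicOn (n : ℕ) (u : ℂ → ℂ) (U : Set ℂ) : Prop :=
  ContDiffOn ℝ (2 * n : ℕ) u U ∧ ∀ z ∈ U, dz^[n] (dzbar^[n] u) z = 0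

lemma isPolyharmonicOn_zero (n : ℕ) (U : Set ℂ) : IsPolyharmonicOn n 0 U := by
  refine ⟨contDiffOn_const, fun z _ => ?_⟩
  rw [dz_eq_wirtinger, dzbar_eq_wirtinger, iterate_wirtinger_zero, iterate_wirtinger_zero,
    Pi.zero_apply]

lemma isPolyharmonicOn_of_L_eqOn_zero (hU : IsOpen U) {m n N : ℕ} (hm : m + 1 ≤ N)
    (hn : n + 1 ≤ N) (hu : ContDiffOn ℝ (2 * N : ℕ) u U) (h : Set.EqOn (L m n u) 0 U) :
    IsPolyharmonicOn N u U :=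
  ⟨hu, iterate_dz_iterate_dzbar_eqOn_zero_of_le hU hm hn (hu.of_le (by norm_cast; lia))
    (iterate_dz_iterate_dzbar_eqOn_zero hU m n (hu.of_le (by norm_cast; lia)) h)⟩

end GenHarmonic

open GenHarmonic in
theorem mainTheorem4_general {U : Set ℂ} (hU : IsOpen U) (γ₁ γ₂ : ℕ) {r : WithTop ℕ∞}
    (hr : (2 * max (γ₁ + 1) (γ₂ + 1) : ℕ) ≤ r) {u : ℂ → ℂ} (hu : ContDiffOn ℝ r u U)
    (h : Set.EqOn (L γ₁ γ₂ u) 0 U) :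
    (∃ P₁ P₂ P₃ : ℂ → ℂ,
      ContDiffOn ℝ r P₁ U ∧ ContDiffOn ℝ r P₂ U ∧ ContDiffOn ℝ r P₃ U ∧
      IsPolyharmonicOn (γ₁ + 1) P₁ U ∧ IsPolyharmonicOn (γ₂ + 1) P₂ U ∧
      IsPolyharmonicOn (min (γ₁ + 1) (γ₂ + 1)) P₃ U ∧
      ∀ z ∈ U, u z = P₁ z + P₂ z + P₃ z) ∧
    IsPolyharmonicOn (max (γ₁ + 1) (γ₂ + 1)) u U := by
  have hmax : IsPolyharmonicOn (max (γ₁ + 1) (γ₂ + 1)) u U :=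
    isPolyharmonicOn_of_L_eqOn_zero hU (le_max_left _ _) (le_max_right _ _) (hu.of_le hr) h
  refine ⟨?_, hmax⟩
  have hzero : ContDiffOn ℝ r (0 : ℂ → ℂ) U := contDiffOn_const
  -- `u` itself serves as the summand of the larger of the two orders.
  rcases max_choice (γ₁ + 1) (γ₂ + 1) with hmax_eq | hmax_eq <;> rw [hmax_eq] at hmax
  · exact ⟨u, 0, 0, hu, hzero, hzero, hmax, isPolyharmonicOn_zero _ U,
      isPolyharmonicOn_zero _ U, fun z _ => by simp⟩
  · exact ⟨0, u, 0, hzero, hu, hzero, isPolyharmonicOn_zero _ U, hmax,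
      isPolyharmonicOn_zero _ U, fun z _ => by simp⟩

theorem mainTheorem4 :
    (∀ (γ₁ γ₂ : ℕ) (u : ℂ → ℂ), GenHarmonic.SmoothOnDisc u →
      GenHarmonic.IsHarmonicWith γ₁ γ₂ u →
        (∃ P₁ P₂ P₃ : ℂ → ℂ,
          GenHarmonic.SmoothOnDisc P₁ ∧ GenHarmonic.SmoothOnDisc P₂ ∧
          GenHarmonic.SmoothOnDisc P₃ ∧
          GenHarmonic.IsPolyharmonic (γ₁ + 1) P₁ ∧
          GenHarmonic.IsPolyharmonic (γ₂ + 1) P₂ ∧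
          GenHarmonic.IsPolyharmonic (min (γ₁ + 1) (γ₂ + 1)) P₃ ∧
          ∀ z ∈ GenHarmonic.disc, u z = P₁ z + P₂ z + P₃ z) ∧
        GenHarmonic.IsPolyharmonic (max (γ₁ + 1) (γ₂ + 1)) u) ∧
    (∀ (n : ℕ) (u : ℂ → ℂ), 0 < n → GenHarmonic.SmoothOnDisc u →
      GenHarmonic.IsHarmonicWith ((n : ℂ) - 1) ((n : ℂ) - 1) u →
        GenHarmonic.IsPolyharmonic n u) := by
  have hdisc : IsOpen GenHarmonic.disc := Metric.isOpen_ball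
  have hle (N : ℕ) : (N : WithTop ℕ∞) ≤ ∞ := WithTop.coe_le_coe.2 le_top
  refine ⟨fun γ₁ γ₂ u hu h => mainTheorem4_general hdisc γ₁ γ₂ (hle _) hu h.2, ?_⟩
  rintro (_ | k) u hn hu h
  · exact absurd hn (lt_irrefl 0)
  · have hL : Set.EqOn (GenHarmonic.L k k u) 0 GenHarmonic.disc :=
      fun z hz => by simpa using h.2 z hz
    exact max_self (k + 1) ▸ (mainTheorem4_general hdisc k k (hle _) hu hL).2
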